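/- Let $d\ge 2$ and let $\mathbb S^d$ be the unit sphere of $\mathbb R^{d+1}$ with the Euclidean metric. Let $\sigma_d$ be the normalized (total mass one) uniform surface measure on $\mathbb S^d$, let $\mathcal H_s$ be the $s$-dimensional Hausdorff measure (defined by covers weighted by $\operatorname{diam}(\cdot)^s$, so that $\mathcal H_0$ is the counting measure), and let $C(x,t)=\{z\in\mathbb S^d : z\cdot x\ge t\}$ denote spherical caps. For $X\subset\mathbb S^d$ with $0<\mathcal H_s(X)<\infty$, the $s$-dimensional spherical cap $\mathbb L_2$-discrepancy is $$D^{C}_{\mathbb L_2,s}(X)=\left(\int_{-1}^1\int_{\mathbb S^d}\left|\frac{\mathcal H_s(X\cap C(x,t))}{\mathcal H_s(X)}-\sigma_d(C(x,t))\right|^2 d\sigma_d(x)\,dt\right)^{1/2}.$$ The set $X$ is called lower Ahlfors--David regular in dimension $s$ with constant $a>0$ if $\mathcal H_s(\{y\in X:\|x-y\|<\varepsilon\})\ge a\,\varepsilon^s$ for every $x\in X$ and every $\varepsilon\in(0,1)$. Theorem. For every $d\ge2$ and every $s\in[0,d)$ there is a constant $c_{d,s}>0$, depending only on $d$ and $s$,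 such that for every set $X\subset\mathbb S^d$ of Hausdorff dimension $s$ with $1\le\mathcal H_s(X)<\infty$ which is lower Ahlfors--David regular in dimension $s$ with constant $a>0$, $$D^{C}_{\mathbb L_2,s}(X)\ \ge\ c_{d,s}\left(\frac{\mathcal H_s(X)}{a}\right)^{-\frac{d+1}{2(d-s)}}.$$ -/

import Mathlib

open MeasureTheory Metric
open scoped ENNReal

noncomputable section

/-- The unit sphere `𝕊^d` of the Euclidean space `ℝ^(d+1)`, with the Euclidean (chordal) metric. -/
abbrev UnitSphere (d : ℕ) : Type :=
  sphere (0 : EuclideanSpace ℝ (Fin (d + 1))) 1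

/-- The uniform surface area measure `σ_d` on `𝕊^d`, normalized to have total mass one. -/
def uniformSphere (d : ℕ) : Measure (UnitSphere d) :=
  ((volume : Measure (EuclideanSpace ℝ (Fin (d + 1)))).toSphere Set.univ)⁻¹ •
    (volume : Measure (EuclideanSpace ℝ (Fin (d + 1)))).toSphere

/-- The spherical cap `C(x, t) = {z ∈ 𝕊^d : z · x ≥ t}`. -/
def sphericalCap {d : ℕ} (x : UnitSphere d) (t : ℝ) : Set (UnitSphere d) :=
  {z | t ≤ inner ℝ (z : EuclideanSpace ℝ (Fin (d + 1))) (x : EuclideanSpace ℝ (Fin (d + 1)))}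

/-- The `s`-dimensional spherical cap `L²`-discrepancy of a set `X ⊆ 𝕊^d`, in which the
normalized `s`-dimensional Hausdorff measure of `X` is compared with `σ_d` on all caps. It is
meaningful when `0 < μH[s] X < ∞`. -/
def capDiscrepancy {d : ℕ} (s : ℝ) (X : Set (UnitSphere d)) : ℝ :=
  Real.sqrt (∫ t in (-1 : ℝ)..1, ∫ x : UnitSphere d,
    |(μH[s] (X ∩ sphericalCap x t)).toReal / (μH[s] X).toReal
      - (uniformSphere d (sphericalCap x t)).toReal| ^ 2 ∂(uniformSphere d))

/-- `X ⊆ 𝕊^d` is lower Ahlfors--David regular in dimension `s` with constant `a > 0`: every ball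
of radius `ε ∈ (0, 1)` centred at a point of `X` meets `X` in a set of `s`-dimensional Hausdorff
measure at least `a ε^s`. -/
def IsLowerADRegular {d : ℕ} (s a : ℝ) (X : Set (UnitSphere d)) : Prop :=
  0 < a ∧ ∀ x ∈ X, ∀ ε : ℝ, 0 < ε → ε < 1 →
    ENNReal.ofReal (a * ε ^ s) ≤ μH[s] (ball x ε ∩ X)

end

/-! The squared discrepancy is an energy, and an energy can be bounded below at a single scale `ε`.
Let `ν` be normalized Hausdorff measure on `X`, `σ` the uniform measure and `N = μH[s] X / a`. By
Stolarsky's principle (`exists_cap_discrepancy_eq_energy`) the squared discrepancy is a negative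
multiple of the energy of `ν - σ` for the kernel `|z - w|`. This kernel is a superposition of `1 -
exp (-u |z - w| ^ 2)` with weight `u ^ (-3/2)`, and constants have zero energy, so the squared
discrepancy is a positive superposition of Gaussian energies. Each of these is a squared `L²` norm
over `ℝ^(d+1)` of a difference of Gaussian potentials (`energy_gaussianKernel`), hence nonnegative,
and only `u` between `ε⁻²` and `2 ε⁻²` need be kept.

By lower regularity, `X` is covered by `O(N ε^(-s))` balls of radius comparable to `ε`. Their total
volume `O(N ε^(d+1-s))` is at most half of the volume, of order `ε`, of the shell `1 - ε < ‖y‖ < 1`,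
once `N ε^(d-s)` is a small constant (`exists_shell_subset_far`). On the rest of the shell the
potential of `σ` is at least of order `ε^d`, while that of `ν` is smaller on average. Cauchy–Schwarz
then gives Gaussian energy at least of order `ε^d` (`exists_mul_pow_le_energy`). Integrating in `u`
contributes another factor `ε`, so the squared discrepancy is at least of order `ε^(d+1)`, that is,
`N^(-(d+1)/(d-s))`. -/

/-! ### The uniform measure: invariance and the size of caps -/

instance isProbabilityMeasure_uniformSphere (d : ℕ) : IsProbabilityMeasure (uniformSphere d) := by
  constructor
  rw [uniformSphere, Measure.smul_apply, smul_eq_mul]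
  exact ENNReal.inv_mul_cancel
    (Measure.measure_univ_ne_zero.2 (Measure.toSphere_ne_zero _)) (measure_ne_top _ _)

instance isOpenPosMeasure_uniformSphere (d : ℕ) : (uniformSphere d).IsOpenPosMeasure where
  open_pos U hU hne := by
    rw [uniformSphere, Measure.smul_apply, smul_eq_mul]
    exact mul_ne_zero (ENNReal.inv_ne_zero.2 (measure_ne_top _ _)) (hU.measure_ne_zero _ hne)

/-- The action of a linear isometry on the unit sphere. -/
noncomputable def sphereIsometry {d : ℕ}
    (g : EuclideanSpace ℝ (Fin (d + 1)) ≃ₗᵢ[ℝ] EuclideanSpace ℝ (Fin (d + 1)))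
    (x : UnitSphere d) : UnitSphere d :=
  ⟨g x, by simp⟩

theorem continuous_sphereIsometry {d : ℕ}
    (g : EuclideanSpace ℝ (Fin (d + 1)) ≃ₗᵢ[ℝ] EuclideanSpace ℝ (Fin (d + 1))) :
    Continuous (sphereIsometry g) :=
  (g.continuous.comp continuous_subtype_val).subtype_mk _

-- The sphere measure of `S` is proportional to the Lebesgue measure of the cone over `S`, and
-- linear isometries preserve both cones and Lebesgue measure.
open scoped Pointwise in
theorem map_sphereIsometry_uniformSphere {d : ℕ}
    (g : EuclideanSpace ℝ (Fin (d + 1)) ≃ₗᵢ[ℝ] EuclideanSpace ℝ (Fin (d + 1))) :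
    (uniformSphere d).map (sphereIsometry g) = uniformSphere d := by
  ext S hS
  have hm := (continuous_sphereIsometry g).measurable
  rw [Measure.map_apply hm hS]
  simp only [uniformSphere, Measure.smul_apply, smul_eq_mul]
  rw [Measure.toSphere_apply' _ (hm hS), Measure.toSphere_apply' _ hS]
  congr 2
  conv_rhs => rw [← g.measurePreserving.measure_preimage_emb g.toHomeomorph.measurableEmbedding]
  congr 1
  ext y
  simp only [Set.mem_smul, Set.mem_image, Set.mem_preimage, Subtype.exists, exists_and_right,
    exists_eq_right]
  constructor
  · rintro ⟨r, hr, z, ⟨hz, hzS⟩, rfl⟩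
    exact ⟨r, hr, g z, ⟨by simpa using hz, hzS⟩, by simp⟩
  · rintro ⟨r, hr, z, ⟨hz, hzS⟩, h⟩
    refine ⟨r, hr, g.symm z, ⟨by simpa using hz, ?_⟩, ?_⟩
    · simpa [sphereIsometry] using hzS
    · apply g.injective
      simp [h]

theorem integral_comp_sphereIsometry {d : ℕ}
    (g : EuclideanSpace ℝ (Fin (d + 1)) ≃ₗᵢ[ℝ] EuclideanSpace ℝ (Fin (d + 1)))
    {f : UnitSphere d → ℝ} (hf : Continuous f) :
    ∫ x, f (sphereIsometry g x) ∂uniformSphere d = ∫ x, f x ∂uniformSphere d := by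
  conv_rhs => rw [← map_sphereIsometry_uniformSphere g]
  rw [integral_map (continuous_sphereIsometry g).aemeasurable hf.aestronglyMeasurable]

theorem integral_inner_uniformSphere {d : ℕ} (v : EuclideanSpace ℝ (Fin (d + 1))) :
    ∫ x : UnitSphere d, inner ℝ v (x : EuclideanSpace ℝ (Fin (d + 1))) ∂uniformSphere d = 0 := by
  have h := integral_comp_sphereIsometry (d := d) (LinearIsometryEquiv.neg ℝ)
    (f := fun x ↦ inner ℝ v (x : EuclideanSpace ℝ (Fin (d + 1)))) (by fun_prop)
  simp only [sphereIsometry, LinearIsometryEquiv.coe_neg, inner_neg_right, integral_neg] at h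
  linarith

/-- The mean of `|x · v|` over the sphere is proportional to `‖v‖`. -/
theorem exists_integral_abs_inner_uniformSphere (d : ℕ) :
    ∃ c : ℝ, 0 < c ∧ ∀ v : EuclideanSpace ℝ (Fin (d + 1)),
      ∫ x : UnitSphere d, |inner ℝ v (x : EuclideanSpace ℝ (Fin (d + 1)))| ∂uniformSphere d
        = c * ‖v‖ := by
  let e : EuclideanSpace ℝ (Fin (d + 1)) := EuclideanSpace.single 0 1
  have he : ‖e‖ = 1 := by simp [e]
  refine ⟨∫ x : UnitSphere d, |inner ℝ e (x : EuclideanSpace ℝ (Fin (d + 1)))| ∂uniformSphere d,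
    ?_, fun v ↦ ?_⟩
  · refine Continuous.integral_pos_of_hasCompactSupport_nonneg_nonzero
      (f := fun x : UnitSphere d ↦ |inner ℝ e (x : EuclideanSpace ℝ (Fin (d + 1)))|)
      (x := ⟨e, by simpa using he⟩) (by fun_prop)
      (HasCompactSupport.of_compactSpace _) (fun _ ↦ abs_nonneg _) ?_
    simp [he]
  · have hn : ‖‖v‖ • e‖ = ‖v‖ := by simp [norm_smul, he]
    -- A reflection exchanging two vectors of equal norm reduces every `v` to a multiple of `e`.
    let g := (ℝ ∙ (‖v‖ • e - v))ᗮ.reflection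
    have hg : g (‖v‖ • e) = v := Submodule.reflection_sub hn
    have h := integral_comp_sphereIsometry (d := d) g
      (f := fun x ↦ |inner ℝ v (x : EuclideanSpace ℝ (Fin (d + 1)))|) (by fun_prop)
    rw [← h, mul_comm, ← integral_const_mul]
    congr 1 with x
    simp only [sphereIsometry]
    conv_lhs => rw [← hg]
    rw [g.inner_map_map, inner_smul_left, abs_mul]
    simp

open scoped Pointwise in
/-- Caps of radius `ε` have measure at least of order `ε ^ d`. -/
theorem le_uniformSphere_ball {d : ℕ} (p : UnitSphere d) {δ : ℝ} (hδ : 0 < δ) (hδ' : δ ≤ 1 / 4) :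
    δ ^ d / (2 * (d + 1)) ≤ (uniformSphere d).real (ball p (4 * δ)) := by
  set E := EuclideanSpace ℝ (Fin (d + 1))
  set B : Set (UnitSphere d) := ball p (4 * δ)
  set K : Set E := Set.Ioo (0 : ℝ) 1 • ((↑) '' B)
  have hdim : Module.finrank ℝ E = d + 1 := by simp [E]
  set ω : ℝ := (volume : Measure E).real (ball 0 1)
  have hω : 0 < ω :=
    ENNReal.toReal_pos (measure_ball_pos _ _ one_pos).ne' measure_ball_lt_top.ne
  have hp : ‖(p : E)‖ = 1 := by simp
  have hKball : K ⊆ ball 0 1 := by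
    rintro _ ⟨r, hr, _, ⟨q, -, rfl⟩, rfl⟩
    have : ‖(q : E)‖ = 1 := by simp
    simp [norm_smul, abs_of_pos hr.1, hr.2]
  have hKfin : volume K ≠ ∞ := ((measure_mono hKball).trans_lt measure_ball_lt_top).ne
  have hσ : (uniformSphere d).real B = volume.real K / ω := by
    have h1 : (volume : Measure E).toSphere.real B = (d + 1) * volume.real K := by
      rw [measureReal_def, Measure.toSphere_apply' _ measurableSet_ball, hdim,
        ENNReal.toReal_mul, ENNReal.toReal_natCast, Nat.cast_succ]
      rfl
    have h2 : (volume : Measure E).toSphere.real Set.univ = (d + 1) * ω := by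
      rw [Measure.toSphere_real_apply_univ, hdim]; simp [ω]
    have h3 : (uniformSphere d).real B = ((volume : Measure E).toSphere.real Set.univ)⁻¹ *
        (volume : Measure E).toSphere.real B := by
      simp [uniformSphere, measureReal_def, E]
    rw [h3, h1, h2]
    field_simp
  rw [hσ]
  set a : ℝ := 1 - 2 * δ
  have ha0 : 0 < a := by simp only [a]; linarith
  have ha1 : a < 1 := by simp only [a]; linarith
  -- The layer `K \ (a • K)` of the cone over the cap has thickness `2 * δ`, just enough for a ball
  -- of radius `δ`. Projecting a point of that ball to the sphere moves it by less than `2 * δ`;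
  -- with the radius and the distance from centre to `p` this explains `4 * δ`.
  have hsub : ball ((1 - δ) • (p : E)) δ ⊆ K \ (a • K) := by
    intro y hy
    have hy' : ‖y - (1 - δ) • (p : E)‖ < δ := by simpa [dist_eq_norm] using hy
    have hc : ‖(1 - δ) • (p : E)‖ = 1 - δ := by
      rw [norm_smul, hp, mul_one, Real.norm_of_nonneg (by linarith)]
    have hy1 : ‖y‖ < 1 := by
      have := norm_le_norm_add_norm_sub' y ((1 - δ) • (p : E)); linarith
    have hy2 : a < ‖y‖ := by
      have := norm_le_norm_add_norm_sub ((1 - δ) • (p : E)) y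
      rw [norm_sub_rev] at hy'
      have h3 := norm_sub_norm_le ((1 - δ) • (p : E)) y
      simp only [a]; linarith
    have hy0 : 0 < ‖y‖ := ha0.trans hy2
    refine ⟨?_, ?_⟩
    · refine ⟨‖y‖, ⟨hy0, hy1⟩, ‖y‖⁻¹ • y, ⟨⟨‖y‖⁻¹ • y, ?_⟩, ?_, rfl⟩, ?_⟩
      · simp [norm_smul, hy0.ne']
      · have e1 : ‖‖y‖⁻¹ • y - y‖ < 2 * δ := by
          have : ‖y‖⁻¹ • y - y = (‖y‖⁻¹ - 1) • y := by rw [sub_smul, one_smul]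
          rw [this, norm_smul, Real.norm_of_nonneg (by
            rw [sub_nonneg]; exact (one_le_inv₀ hy0).2 hy1.le), sub_mul,
            inv_mul_cancel₀ hy0.ne']
          simp only [a] at hy2; linarith
        have e2 : ‖(1 - δ) • (p : E) - p‖ = δ := by
          have : (1 - δ) • (p : E) - p = (-δ) • (p : E) := by module
          rw [this, norm_smul, hp, norm_neg, Real.norm_of_nonneg hδ.le, mul_one]
        show dist _ _ < _
        rw [Subtype.dist_eq, dist_eq_norm]
        calc ‖‖y‖⁻¹ • y - p‖
            = ‖(‖y‖⁻¹ • y - y) + (y - (1 - δ) • (p : E)) + ((1 - δ) • (p : E) - p)‖ := by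
              congr 1; abel
          _ ≤ _ := norm_add₃_le
          _ < _ := by linarith
      · simp [smul_smul, hy0.ne']
    · rintro ⟨z, hz, rfl⟩
      have := hKball hz
      simp only [mem_ball_zero_iff] at this
      simp only [norm_smul, Real.norm_of_nonneg ha0.le] at hy2
      nlinarith
  have haK : a • K ⊆ K := by
    rintro _ ⟨_, ⟨r, hr, q, hq, rfl⟩, rfl⟩
    exact ⟨a * r, ⟨mul_pos ha0 hr.1, by nlinarith [hr.1, hr.2]⟩, q, hq, by simp [mul_smul]⟩
  have hKmeas : MeasurableSet K :=
    (isOpen_Ioo.smul_sphere one_ne_zero (by simp) isOpen_ball).measurableSet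
  have hvol : volume.real (K \ (a • K)) = (1 - a ^ (d + 1)) * volume.real K := by
    rw [measureReal_sdiff haK (hKmeas.const_smul₀ a) (h₁ := hKfin)]
    have : volume.real (a • K) = a ^ (d + 1) * volume.real K := by
      rw [measureReal_def, Measure.addHaar_smul, hdim, ENNReal.toReal_mul,
        ENNReal.toReal_ofReal (abs_nonneg _), abs_of_pos (by positivity), measureReal_def]
    rw [this]; ring
  have hball : (volume : Measure E).real (ball ((1 - δ) • (p : E)) δ) = δ ^ (d + 1) * ω := by
    rw [measureReal_def, Measure.addHaar_ball _ _ hδ.le, hdim, ENNReal.toReal_mul,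
      ENNReal.toReal_ofReal (by positivity)]
    rfl
  have hle : δ ^ (d + 1) * ω ≤ (1 - a ^ (d + 1)) * volume.real K := by
    rw [← hball, ← hvol]
    exact measureReal_mono hsub ((measure_mono Set.sdiff_subset).trans_lt hKfin.lt_top).ne
  -- By Bernoulli the layer is a fraction `O(δ)` of the cone, so one power of `δ` cancels against `δ
  -- ^ (d + 1)`.
  have hbern : 1 - a ^ (d + 1) ≤ 2 * (d + 1) * δ := by
    have := one_add_mul_le_pow (a := -(2 * δ)) (by linarith) (d + 1)
    have e : (1 : ℝ) + -(2 * δ) = a := by simp only [a]; ring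
    rw [e] at this
    push_cast at this
    linarith
  have hK0 : 0 ≤ volume.real K := measureReal_nonneg
  have : δ ^ d * ω * δ ≤ (2 * (d + 1) * volume.real K) * δ := by
    calc _ = δ ^ (d + 1) * ω := by ring
      _ ≤ _ := hle
      _ ≤ (2 * (d + 1) * δ) * volume.real K := by gcongr
      _ = _ := by ring
  have := le_of_mul_le_mul_right this hδ
  rw [div_le_div_iff₀ (by positivity) hω]
  linarith

/-! ### Energies of differences of probability measures -/

/-- The energy `∬ k d(α - β) d(α - β)` of a symmetric kernel `k`. -/
noncomputable def energy {Ω : Type*} [MeasurableSpace Ω] (α β : Measure Ω) (k : Ω × Ω → ℝ) : ℝ :=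
  ∫ p, k p ∂α.prod α + ∫ p, k p ∂β.prod β - 2 * ∫ p, k p ∂α.prod β

section Energy

variable {Ω Θ : Type*} [MeasurableSpace Ω] [MeasurableSpace Θ] (α β : Measure Ω)
  [IsProbabilityMeasure α] [IsProbabilityMeasure β]

/-- Both measures have mass one, so the constant contributes `a + a - 2 * a = 0`. -/
theorem energy_const_add_mul (a b : ℝ) {k : Ω × Ω → ℝ}
    (hk : ∀ μ : Measure (Ω × Ω), IsProbabilityMeasure μ → Integrable k μ) :
    energy α β (fun p ↦ a + b * k p) = b * energy α β k := by
  have h : ∀ μ : Measure (Ω × Ω), IsProbabilityMeasure μ →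
      ∫ p, a + b * k p ∂μ = a + b * ∫ p, k p ∂μ := fun μ hμ ↦ by
    rw [integral_add (integrable_const _) ((hk μ hμ).const_mul b), integral_const_mul]
    simp
  rw [energy, energy, h _ inferInstance, h _ inferInstance, h _ inferInstance]
  ring

theorem energy_mul {F : Ω → ℝ} :
    energy α β (fun p ↦ F p.1 * F p.2) = (∫ z, F z ∂α - ∫ z, F z ∂β) ^ 2 := by
  rw [energy, integral_prod_mul, integral_prod_mul, integral_prod_mul]
  ring

variable {m : Measure Θ} [SFinite m] {h : Θ → Ω × Ω → ℝ}

omit [SFinite m] in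
theorem integrable_energy (hh : ∀ μ : Measure (Ω × Ω), IsProbabilityMeasure μ →
    Integrable (Function.uncurry h) (m.prod μ)) :
    Integrable (fun θ ↦ energy α β (h θ)) m :=
  ((hh (α.prod α) inferInstance).integral_prod_left.add
    (hh (β.prod β) inferInstance).integral_prod_left).sub
    ((hh (α.prod β) inferInstance).integral_prod_left.const_mul 2)

/-- Fubini on each of the three terms. Quantifying over all probability measures `μ` covers the
three product measures at once. -/
theorem energy_integral (hh : ∀ μ : Measure (Ω × Ω), IsProbabilityMeasure μ →
    Integrable (Function.uncurry h) (m.prod μ)) :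
    energy α β (fun p ↦ ∫ θ, h θ p ∂m) = ∫ θ, energy α β (h θ) ∂m := by
  have key : ∀ μ : Measure (Ω × Ω), IsProbabilityMeasure μ →
      ∫ p, ∫ θ, h θ p ∂m ∂μ = ∫ θ, ∫ p, h θ p ∂μ ∂m := fun μ hμ ↦
    (integral_integral_swap (hh μ hμ)).symm
  have hi : ∀ μ : Measure (Ω × Ω), IsProbabilityMeasure μ →
      Integrable (fun θ ↦ ∫ p, h θ p ∂μ) m := fun μ hμ ↦ (hh μ hμ).integral_prod_left
  simp only [energy]
  rw [key _ inferInstance, key _ inferInstance, key _ inferInstance, integral_sub,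
    integral_add (hi _ inferInstance) (hi _ inferInstance), integral_const_mul]
  · exact (hi _ inferInstance).add (hi _ inferInstance)
  · exact (hi _ inferInstance).const_mul 2

end Energy

/-! ### Stolarsky's invariance principle -/

section Stolarsky

theorem measurableSet_sphericalCap {d : ℕ} (x : UnitSphere d) (t : ℝ) :
    MeasurableSet (sphericalCap x t) := by
  apply IsClosed.measurableSet
  exact isClosed_le continuous_const (by fun_prop)

/-- The integral is the length `1 + min a b`. Writing the minimum through `|a - b|` isolates the
term that becomes the distance after averaging over cap centres. -/
theorem setIntegral_indicator_Iic_mul_indicator_Iic {a b : ℝ} (ha : a ∈ Set.Icc (-1 : ℝ) 1)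
    (hb : b ∈ Set.Icc (-1 : ℝ) 1) :
    ∫ t in Set.Ioc (-1 : ℝ) 1, (Set.Iic a).indicator 1 t * (Set.Iic b).indicator 1 t
      = 1 + (a + b - |a - b|) / 2 := by
  have h1 : (fun t : ℝ ↦ (Set.Iic a).indicator (1 : ℝ → ℝ) t * (Set.Iic b).indicator 1 t)
      = (Set.Iic (min a b)).indicator 1 := by
    rw [← Set.Iic_inter_Iic, Set.inter_indicator_one]
    rfl
  have hm : min a b ≤ 1 := (min_le_left _ _).trans ha.2
  have hm' : -1 ≤ min a b := le_min ha.1 hb.1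
  rw [h1, integral_indicator_one measurableSet_Iic, measureReal_restrict_apply measurableSet_Iic,
    Set.inter_comm, Set.Ioc_inter_Iic, min_eq_right hm, Real.volume_real_Ioc_of_le hm']
  rcases le_total a b with hab | hab
  · rw [min_eq_left hab, abs_of_nonpos (by linarith)]; ring
  · rw [min_eq_right hab, abs_of_nonneg (by linarith)]; ring

/-- Stolarsky's invariance principle, for the `L²` discrepancy of a probability measure. -/
theorem exists_cap_discrepancy_eq_energy (d : ℕ) :
    ∃ c : ℝ, 0 < c ∧ ∀ ν : Measure (UnitSphere d), IsProbabilityMeasure ν →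
      ∫ t in (-1 : ℝ)..1, ∫ x, |ν.real (sphericalCap x t)
        - (uniformSphere d).real (sphericalCap x t)| ^ 2 ∂uniformSphere d =
      -c * energy ν (uniformSphere d) (fun p ↦ dist p.1 p.2) := by
  obtain ⟨c, hc, hcv⟩ := exists_integral_abs_inner_uniformSphere d
  refine ⟨c / 2, by positivity, fun ν hν ↦ ?_⟩
  set σ := uniformSphere d
  let F : ℝ × UnitSphere d → UnitSphere d → ℝ := fun θ z ↦ (sphericalCap θ.2 θ.1).indicator 1 z
  let m : Measure (ℝ × UnitSphere d) := (volume.restrict (Set.Ioc (-1) 1)).prod σ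
  have hmeas : Measurable fun q : (ℝ × UnitSphere d) × UnitSphere d ↦ F q.1 q.2 := by
    have : (fun q : (ℝ × UnitSphere d) × UnitSphere d ↦ F q.1 q.2) =
        {q : (ℝ × UnitSphere d) × UnitSphere d | q.1.1 ≤
          inner ℝ (q.2 : EuclideanSpace ℝ (Fin (d + 1))) q.1.2}.indicator 1 := by
      rfl
    rw [this]
    exact measurable_one.indicator (isClosed_le (by fun_prop) (by fun_prop)).measurableSet
  have hF : ∀ θ z, ‖F θ z‖ ≤ 1 := fun θ z ↦ by
    simp only [F, Set.indicator]; split_ifs <;> simp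
  have hint : ∀ μ : Measure (UnitSphere d × UnitSphere d), IsProbabilityMeasure μ →
      Integrable (Function.uncurry fun θ p ↦ F θ p.1 * F θ p.2) (m.prod μ) := fun μ hμ ↦ by
    refine Integrable.of_bound (C := 1) (Measurable.aestronglyMeasurable ?_) ?_
    · exact (hmeas.comp (by fun_prop : Measurable fun q : (ℝ × UnitSphere d) ×
        (UnitSphere d × UnitSphere d) ↦ (q.1, q.2.1))).mul
        (hmeas.comp (by fun_prop : Measurable fun q : (ℝ × UnitSphere d) ×
        (UnitSphere d × UnitSphere d) ↦ (q.1, q.2.2)))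
    · refine Filter.Eventually.of_forall fun q ↦ ?_
      simp only [Function.uncurry, norm_mul]
      exact mul_le_one₀ (hF _ _) (norm_nonneg _) (hF _ _)
  -- Integrate over the height `t` first. Over the centres `x`, the linear term averages to zero by
  -- antipodal symmetry, and the absolute value averages to `c * dist p.1 p.2`.
  have hk : ∀ p : UnitSphere d × UnitSphere d, ∫ θ, F θ p.1 * F θ p.2 ∂m
      = 1 + -(c / 2) * dist p.1 p.2 := fun p ↦ by
    have hi : Integrable (fun θ ↦ F θ p.1 * F θ p.2) m := by
      refine Integrable.of_bound (C := 1) (Measurable.aestronglyMeasurable ?_) ?_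
      · exact (hmeas.comp (measurable_id.prodMk measurable_const)).mul
          (hmeas.comp (measurable_id.prodMk measurable_const))
      · refine Filter.Eventually.of_forall fun q ↦ ?_
        rw [norm_mul]
        exact mul_le_one₀ (hF _ _) (norm_nonneg _) (hF _ _)
    rw [integral_prod_symm _ hi]
    have hmem : ∀ z x : UnitSphere d, inner ℝ (z : EuclideanSpace ℝ (Fin (d + 1)))
        (x : EuclideanSpace ℝ (Fin (d + 1))) ∈ Set.Icc (-1 : ℝ) 1 := fun z x ↦ by
      have := abs_real_inner_le_norm (z : EuclideanSpace ℝ (Fin (d + 1)))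
        (x : EuclideanSpace ℝ (Fin (d + 1)))
      simpa [abs_le] using this
    have hx : ∀ x : UnitSphere d, ∫ t in Set.Ioc (-1 : ℝ) 1, F (t, x) p.1 * F (t, x) p.2 =
        1 + (inner ℝ ((p.1 : EuclideanSpace ℝ (Fin (d + 1))) + p.2)
          (x : EuclideanSpace ℝ (Fin (d + 1)))
          - |inner ℝ ((p.1 : EuclideanSpace ℝ (Fin (d + 1))) - p.2)
          (x : EuclideanSpace ℝ (Fin (d + 1)))|) / 2 := fun x ↦ by
      rw [inner_add_left, inner_sub_left,
        ← setIntegral_indicator_Iic_mul_indicator_Iic (hmem p.1 x) (hmem p.2 x)]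
      rfl
    simp_rw [hx]
    have hc1 : Continuous fun x : UnitSphere d ↦
        inner ℝ ((p.1 : EuclideanSpace ℝ (Fin (d + 1))) + p.2)
          (x : EuclideanSpace ℝ (Fin (d + 1))) := by fun_prop
    have hc2 : Continuous fun x : UnitSphere d ↦
        |inner ℝ ((p.1 : EuclideanSpace ℝ (Fin (d + 1))) - p.2)
          (x : EuclideanSpace ℝ (Fin (d + 1)))| := by fun_prop
    have hi1 := hc1.integrable_of_hasCompactSupport (μ := σ) (HasCompactSupport.of_compactSpace _)
    have hi2 := hc2.integrable_of_hasCompactSupport (μ := σ) (HasCompactSupport.of_compactSpace _)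
    have hi3 : Integrable (fun x : UnitSphere d ↦
        (inner ℝ ((p.1 : EuclideanSpace ℝ (Fin (d + 1))) + p.2)
          (x : EuclideanSpace ℝ (Fin (d + 1)))
          - |inner ℝ ((p.1 : EuclideanSpace ℝ (Fin (d + 1))) - p.2)
          (x : EuclideanSpace ℝ (Fin (d + 1)))|) / 2) σ := (hi1.sub hi2).div_const 2
    rw [integral_add (integrable_const _) hi3, integral_div,
      integral_sub hi1 hi2, hcv, integral_inner_uniformSphere]
    simp only [integral_const, probReal_univ, smul_eq_mul, Subtype.dist_eq, dist_eq_norm]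
    ring
  have hsq : ∀ θ, energy ν σ (fun p ↦ F θ p.1 * F θ p.2) =
      |ν.real (sphericalCap θ.2 θ.1) - σ.real (sphericalCap θ.2 θ.1)| ^ 2 := fun θ ↦ by
    rw [energy_mul, sq_abs, integral_indicator_one (measurableSet_sphericalCap _ _),
      integral_indicator_one (measurableSet_sphericalCap _ _)]
  have hE := energy_integral ν σ hint
  have hI := integrable_energy ν σ hint
  simp_rw [hk] at hE
  simp_rw [hsq] at hE hI
  rw [energy_const_add_mul] at hE
  · rw [hE, integral_prod _ hI, intervalIntegral.integral_of_le (by norm_num)]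
  · intro μ hμ
    exact (by fun_prop : Continuous fun p : UnitSphere d × UnitSphere d ↦
      dist p.1 p.2).integrable_of_hasCompactSupport (HasCompactSupport.of_compactSpace _)

end Stolarsky

/-! ### The distance as a superposition of Gaussians -/

section Superposition

open Real Set

/-- The common majorant of all superposition integrands on the sphere: it is of order `u ^ (-1/2)`
near zero and `u ^ (-3/2)` at infinity. The `4` is the squared diameter. -/
theorem integrableOn_rpow_mul_min :
    IntegrableOn (fun u : ℝ ↦ u ^ (-(3 / 2) : ℝ) * min 1 (4 * u)) (Ioi 0) := by
  have hm : Measurable fun u : ℝ ↦ u ^ (-(3 / 2) : ℝ) * min 1 (4 * u) := by fun_prop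
  rw [← Ioc_union_Ioi_eq_Ioi zero_le_one]
  refine IntegrableOn.union ?_ ?_
  · have h1 : IntegrableOn (fun u : ℝ ↦ 4 * u ^ (-(1 / 2) : ℝ)) (Ioc 0 1) := by
      have := (intervalIntegral.intervalIntegrable_rpow' (a := 0) (b := 1)
        (r := -(1 / 2)) (by norm_num)).1
      exact this.const_mul 4
    refine Integrable.mono' h1 hm.aestronglyMeasurable ?_
    refine (ae_restrict_iff' measurableSet_Ioc).2 (Filter.Eventually.of_forall fun u hu ↦ ?_)
    have hu0 : 0 < u := hu.1
    rw [Real.norm_of_nonneg (by positivity)]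
    calc u ^ (-(3 / 2) : ℝ) * min 1 (4 * u) ≤ u ^ (-(3 / 2) : ℝ) * (4 * u) := by
          gcongr; exact min_le_right _ _
      _ = 4 * (u ^ (-(3 / 2) : ℝ) * u ^ (1 : ℝ)) := by rw [rpow_one]; ring
      _ = _ := by rw [← rpow_add hu0]; norm_num
  · have h1 : IntegrableOn (fun u : ℝ ↦ u ^ (-(3 / 2) : ℝ)) (Ioi 1) :=
      integrableOn_Ioi_rpow_of_lt (by norm_num) one_pos
    refine Integrable.mono' h1 hm.aestronglyMeasurable ?_
    refine (ae_restrict_iff' measurableSet_Ioi).2 (Filter.Eventually.of_forall fun u hu ↦ ?_)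
    have hu0 : 0 < u := one_pos.trans hu
    rw [Real.norm_of_nonneg (by positivity)]
    exact mul_le_of_le_one_right (by positivity) (min_le_left _ _)

theorem one_sub_exp_neg_mul_sq_le {u r : ℝ} (hu : 0 < u) (hr : 0 ≤ r) (hr2 : r ≤ 2) :
    1 - exp (-u * r ^ 2) ≤ min 1 (4 * u) := by
  refine le_min (by linarith [exp_pos (-u * r ^ 2)]) ?_
  have := add_one_le_exp (-u * r ^ 2)
  have h4 : r ^ 2 ≤ 4 := by nlinarith
  nlinarith [mul_le_mul_of_nonneg_left h4 hu.le]

/-- A multiple of `r` is a superposition of `1 - exp (-u r ^ 2)`. -/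
theorem exists_integral_one_sub_exp_eq : ∃ C : ℝ, 0 < C ∧ ∀ r : ℝ, 0 ≤ r →
    ∫ u in Ioi (0 : ℝ), u ^ (-(3 / 2) : ℝ) * (1 - exp (-u * r ^ 2)) = C * r := by
  refine ⟨∫ u in Ioi (0 : ℝ), u ^ (-(3 / 2) : ℝ) * (1 - exp (-u * 1 ^ 2)), ?_, fun r hr ↦ ?_⟩
  · have hpos : ∀ u ∈ Ioi (0 : ℝ), 0 < u ^ (-(3 / 2) : ℝ) * (1 - exp (-u * 1 ^ 2)) := by
      intro u hu
      have hu0 : 0 < u := hu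
      refine mul_pos (by positivity) ?_
      rw [sub_pos, exp_lt_one_iff]
      linarith
    rw [setIntegral_pos_iff_support_of_nonneg_ae]
    · have : Function.support (fun u : ℝ ↦ u ^ (-(3 / 2) : ℝ) * (1 - exp (-u * 1 ^ 2))) ∩
          Ioi 0 = Ioi 0 := inter_eq_right.2 fun u hu ↦ (hpos u hu).ne'
      rw [this]
      simp
    · exact (ae_restrict_iff' measurableSet_Ioi).2
        (Filter.Eventually.of_forall fun u hu ↦ (hpos u hu).le)
    · refine Integrable.mono' integrableOn_rpow_mul_min
        (Measurable.aestronglyMeasurable (by fun_prop)) ?_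
      refine (ae_restrict_iff' measurableSet_Ioi).2 (Filter.Eventually.of_forall fun u hu ↦ ?_)
      have hu0 : 0 < u := hu
      rw [Real.norm_of_nonneg (hpos u hu).le]
      gcongr
      exact one_sub_exp_neg_mul_sq_le hu0 zero_le_one one_le_two
  · rcases hr.eq_or_lt with rfl | hr
    · simp
    -- Scaling `u` by `r ^ 2` reduces to `r = 1`: the weight yields `r ^ 3`, the differential `r ^
    -- (-2)`.
    have h := integral_comp_mul_left_Ioi
      (fun u : ℝ ↦ u ^ (-(3 / 2) : ℝ) * (1 - exp (-u * 1 ^ 2))) 0 (b := r ^ 2) (by positivity)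
    rw [mul_zero, smul_eq_mul] at h
    have h2 : ∀ u ∈ Ioi (0 : ℝ), u ^ (-(3 / 2) : ℝ) * (1 - exp (-u * r ^ 2)) =
        r ^ 3 * ((r ^ 2 * u) ^ (-(3 / 2) : ℝ) * (1 - exp (-(r ^ 2 * u) * 1 ^ 2))) := by
      intro u hu
      have hu0 : 0 < u := hu
      rw [mul_rpow (by positivity) hu0.le, ← rpow_natCast r 2, ← rpow_mul hr.le,
        ← rpow_natCast r 3]
      have : r ^ ((3 : ℕ) : ℝ) * r ^ (((2 : ℕ) : ℝ) * -(3 / 2)) = 1 := by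
        rw [← rpow_add hr]; norm_num
      have harg : -u * r ^ ((2 : ℕ) : ℝ) = -(r ^ ((2 : ℕ) : ℝ) * u) * 1 ^ 2 := by ring
      rw [harg]
      linear_combination (-(u ^ (-(3 / 2) : ℝ) *
        (1 - exp (-(r ^ ((2 : ℕ) : ℝ) * u) * 1 ^ 2)))) * this
    rw [setIntegral_congr_fun measurableSet_Ioi h2, integral_const_mul, h]
    field_simp

variable {d : ℕ}

/-- The Gaussian kernel `exp (-u |z - w| ^ 2)` on the sphere. -/
noncomputable def gaussianKernel (u : ℝ) (p : UnitSphere d × UnitSphere d) : ℝ :=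
  exp (-u * dist p.1 p.2 ^ 2)

theorem continuous_gaussianKernel (u : ℝ) : Continuous (gaussianKernel (d := d) u) := by
  unfold gaussianKernel
  fun_prop

theorem integrable_gaussianKernel (u : ℝ) (μ : Measure (UnitSphere d × UnitSphere d))
    [IsProbabilityMeasure μ] : Integrable (gaussianKernel u) μ :=
  (continuous_gaussianKernel u).integrable_of_hasCompactSupport (HasCompactSupport.of_compactSpace _)

theorem dist_unitSphere_le_two (x y : UnitSphere d) : dist x y ≤ 2 := by
  rw [Subtype.dist_eq, dist_eq_norm]
  have := norm_sub_le (x : EuclideanSpace ℝ (Fin (d + 1))) y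
  simp only [norm_eq_of_mem_sphere] at this
  linarith

theorem integrable_gaussian_superposition (μ : Measure (UnitSphere d × UnitSphere d))
    [IsProbabilityMeasure μ] :
    Integrable (Function.uncurry fun (u : ℝ) (p : UnitSphere d × UnitSphere d) ↦
      u ^ (-(3 / 2) : ℝ) * (1 - gaussianKernel u p)) ((volume.restrict (Ioi 0)).prod μ) := by
  have hG : Integrable (fun q : ℝ × UnitSphere d × UnitSphere d ↦
      q.1 ^ (-(3 / 2) : ℝ) * min 1 (4 * q.1)) ((volume.restrict (Ioi 0)).prod μ) :=
    Integrable.comp_fst (f := fun u : ℝ ↦ u ^ (-(3 / 2) : ℝ) * min 1 (4 * u))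
      integrableOn_rpow_mul_min μ
  refine hG.mono' (Measurable.aestronglyMeasurable ?_) ?_
  · simp only [Function.uncurry_def, gaussianKernel]
    fun_prop
  · have : ∀ᵐ q ∂((volume.restrict (Ioi (0 : ℝ))).prod μ), q.1 ∈ Ioi (0 : ℝ) :=
      Measure.quasiMeasurePreserving_fst.ae (ae_restrict_mem measurableSet_Ioi)
    filter_upwards [this] with q hq
    have hu0 : 0 < q.1 := hq
    have h1 : gaussianKernel q.1 q.2 ≤ 1 := by
      rw [gaussianKernel, exp_le_one_iff, neg_mul]
      exact neg_nonpos.2 (by positivity)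
    simp only [Function.uncurry_def]
    rw [Real.norm_of_nonneg (mul_nonneg (by positivity) (by linarith))]
    gcongr
    exact one_sub_exp_neg_mul_sq_le hu0 dist_nonneg (dist_unitSphere_le_two _ _)

/-- The `L²` cap discrepancy is a superposition of Gaussian energies. -/
theorem exists_cap_discrepancy_eq_integral_energy (d : ℕ) :
    ∃ c : ℝ, 0 < c ∧ ∀ ν : Measure (UnitSphere d), IsProbabilityMeasure ν →
      IntegrableOn (fun u : ℝ ↦
        u ^ (-(3 / 2) : ℝ) * energy ν (uniformSphere d) (gaussianKernel u)) (Ioi 0) ∧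
      ∫ t in (-1 : ℝ)..1, ∫ x, |ν.real (sphericalCap x t)
        - (uniformSphere d).real (sphericalCap x t)| ^ 2 ∂uniformSphere d =
      c * ∫ u in Ioi (0 : ℝ),
        u ^ (-(3 / 2) : ℝ) * energy ν (uniformSphere d) (gaussianKernel u) := by
  obtain ⟨c, hc, h1⟩ := exists_cap_discrepancy_eq_energy d
  obtain ⟨C, hC, h2⟩ := exists_integral_one_sub_exp_eq
  refine ⟨c / C, by positivity, fun ν hν ↦ ?_⟩
  have hk : ∀ u : ℝ, energy ν (uniformSphere d) (fun p ↦
      u ^ (-(3 / 2) : ℝ) * (1 - gaussianKernel u p)) =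
      -(u ^ (-(3 / 2) : ℝ) * energy ν (uniformSphere d) (gaussianKernel u)) := fun u ↦ by
    have := energy_const_add_mul ν (uniformSphere d) (u ^ (-(3 / 2) : ℝ)) (-u ^ (-(3 / 2) : ℝ))
      (k := gaussianKernel u) fun μ _ ↦
        integrable_gaussianKernel u μ
    rw [← neg_mul, ← this]
    congr 1 with p
    ring
  have hI := integrable_energy ν (uniformSphere d)
    fun μ hμ ↦ integrable_gaussian_superposition (d := d) μ
  have hE := energy_integral ν (uniformSphere d)
    fun μ hμ ↦ integrable_gaussian_superposition (d := d) μ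
  simp_rw [hk] at hI hE
  refine ⟨by simpa [IntegrableOn] using hI.neg, ?_⟩
  rw [h1 ν hν, ← neg_neg (∫ u in Ioi (0 : ℝ), _), ← integral_neg, ← hE]
  have : ∀ p : UnitSphere d × UnitSphere d, ∫ u in Ioi (0 : ℝ), u ^ (-(3 / 2) : ℝ) *
      (1 - gaussianKernel u p) = 0 + C * dist p.1 p.2 := fun p ↦ by
    rw [zero_add]; exact h2 _ dist_nonneg
  simp_rw [this]
  rw [energy_const_add_mul]
  · field_simp
  · intro μ hμ
    exact (by fun_prop : Continuous fun p : UnitSphere d × UnitSphere d ↦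
      dist p.1 p.2).integrable_of_hasCompactSupport (HasCompactSupport.of_compactSpace _)

end Superposition

/-! ### Gaussian energies as squared norms of potentials -/

section GaussianPotential

open Real

variable {d : ℕ}

theorem integrable_exp_neg_mul_dist_sq {b : ℝ} (hb : 0 < b)
    (z : EuclideanSpace ℝ (Fin (d + 1))) :
    Integrable fun y : EuclideanSpace ℝ (Fin (d + 1)) ↦ exp (-b * dist z y ^ 2) := by
  have h : Integrable fun y : EuclideanSpace ℝ (Fin (d + 1)) ↦ exp (-b * ‖y‖ ^ 2) := by
    -- A non-integrable function has integral zero by convention, against the positive closed form.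
    by_contra h
    have h1 := integral_undef h
    rw [GaussianFourier.integral_rexp_neg_mul_sq_norm hb] at h1
    exact absurd h1 (by positivity)
  simpa [dist_eq_norm, norm_sub_rev] using h.comp_sub_right z

theorem integral_exp_neg_mul_dist_sq {b : ℝ} (hb : 0 < b)
    (z : EuclideanSpace ℝ (Fin (d + 1))) :
    ∫ y : EuclideanSpace ℝ (Fin (d + 1)), exp (-b * dist z y ^ 2)
      = (π / b) ^ ((d + 1 : ℝ) / 2) := by
  have h := integral_sub_right_eq_self
    (fun y : EuclideanSpace ℝ (Fin (d + 1)) ↦ exp (-b * ‖y‖ ^ 2)) (μ := volume) z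
  rw [GaussianFourier.integral_rexp_neg_mul_sq_norm hb] at h
  simpa [dist_eq_norm, norm_sub_rev] using h

/-- The Gaussian potential `∫ exp (-2 u |z - y| ^ 2) dα(z)` of a measure on the sphere. -/
noncomputable def gaussianPotential (u : ℝ) (α : Measure (UnitSphere d))
    (y : EuclideanSpace ℝ (Fin (d + 1))) : ℝ :=
  ∫ z : UnitSphere d, exp (-(2 * u) * dist (z : EuclideanSpace ℝ (Fin (d + 1))) y ^ 2) ∂α

/-- The parallelogram law splits the two squared distances to `y` into the distance between the
points and the distance from `y` to their midpoint. Integrating over `y` then leaves a constant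
multiple of the kernel. -/
theorem exp_mul_exp_eq_gaussianKernel (u : ℝ) (p : UnitSphere d × UnitSphere d)
    (y : EuclideanSpace ℝ (Fin (d + 1))) :
    exp (-(2 * u) * dist (p.1 : EuclideanSpace ℝ (Fin (d + 1))) y ^ 2) *
      exp (-(2 * u) * dist (p.2 : EuclideanSpace ℝ (Fin (d + 1))) y ^ 2) =
    gaussianKernel u p * exp (-(4 * u) *
      dist ((2⁻¹ : ℝ) • ((p.1 : EuclideanSpace ℝ (Fin (d + 1))) + p.2)) y ^ 2) := by
  rw [gaussianKernel, ← exp_add, ← exp_add, Subtype.dist_eq]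
  congr 1
  simp only [dist_eq_norm]
  have h := parallelogram_law_with_norm ℝ ((p.1 : EuclideanSpace ℝ (Fin (d + 1))) - y) (p.2 - y)
  have e1 : (p.1 : EuclideanSpace ℝ (Fin (d + 1))) - y + (p.2 - y) =
      (2 : ℝ) • ((2⁻¹ : ℝ) • ((p.1 : EuclideanSpace ℝ (Fin (d + 1))) + p.2) - y) := by module
  have e2 : (p.1 : EuclideanSpace ℝ (Fin (d + 1))) - y - (p.2 - y) = p.1 - p.2 := by abel
  rw [e1, e2, norm_smul, Real.norm_ofNat] at h
  linear_combination u * h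

theorem integrable_exp_mul_exp {u : ℝ} (hu : 0 < u) (μ : Measure (UnitSphere d × UnitSphere d))
    [IsProbabilityMeasure μ] :
    Integrable (Function.uncurry fun (y : EuclideanSpace ℝ (Fin (d + 1)))
      (p : UnitSphere d × UnitSphere d) ↦
        exp (-(2 * u) * dist (p.1 : EuclideanSpace ℝ (Fin (d + 1))) y ^ 2) *
        exp (-(2 * u) * dist (p.2 : EuclideanSpace ℝ (Fin (d + 1))) y ^ 2))
      (volume.prod μ) := by
  have hc : Continuous (Function.uncurry fun (y : EuclideanSpace ℝ (Fin (d + 1)))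
      (p : UnitSphere d × UnitSphere d) ↦
        exp (-(2 * u) * dist (p.1 : EuclideanSpace ℝ (Fin (d + 1))) y ^ 2) *
        exp (-(2 * u) * dist (p.2 : EuclideanSpace ℝ (Fin (d + 1))) y ^ 2)) := by
    simp only [Function.uncurry_def]
    fun_prop
  have h4 : 0 < 4 * u := by positivity
  rw [integrable_prod_iff' hc.aestronglyMeasurable]
  simp only [Function.uncurry_apply_pair, exp_mul_exp_eq_gaussianKernel]
  refine ⟨Filter.Eventually.of_forall fun p ↦
    (integrable_exp_neg_mul_dist_sq h4 _).const_mul _, ?_⟩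
  have : ∀ p : UnitSphere d × UnitSphere d, ∫ y : EuclideanSpace ℝ (Fin (d + 1)),
      ‖gaussianKernel u p * exp (-(4 * u) *
      dist ((2⁻¹ : ℝ) • ((p.1 : EuclideanSpace ℝ (Fin (d + 1))) + p.2)) y ^ 2)‖ =
      gaussianKernel u p * (π / (4 * u)) ^ ((d + 1 : ℝ) / 2) := fun p ↦ by
    rw [← integral_exp_neg_mul_dist_sq h4 ((2⁻¹ : ℝ) •
      ((p.1 : EuclideanSpace ℝ (Fin (d + 1))) + (p.2 : EuclideanSpace ℝ (Fin (d + 1))))), ← integral_const_mul]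
    congr 1 with y
    exact Real.norm_of_nonneg (mul_nonneg (exp_nonneg _) (exp_nonneg _))
  simp_rw [this]
  exact (integrable_gaussianKernel u μ).mul_const _

variable (α β : Measure (UnitSphere d)) [IsProbabilityMeasure α] [IsProbabilityMeasure β]

theorem energy_exp_mul_exp (u : ℝ) (y : EuclideanSpace ℝ (Fin (d + 1))) :
    energy α β (fun p : UnitSphere d × UnitSphere d ↦
      exp (-(2 * u) * dist (p.1 : EuclideanSpace ℝ (Fin (d + 1))) y ^ 2) *
        exp (-(2 * u) * dist (p.2 : EuclideanSpace ℝ (Fin (d + 1))) y ^ 2)) =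
      (gaussianPotential u α y - gaussianPotential u β y) ^ 2 :=
  energy_mul α β (F := fun z : UnitSphere d ↦
    exp (-(2 * u) * dist (z : EuclideanSpace ℝ (Fin (d + 1))) y ^ 2))

theorem integrable_sq_gaussianPotential_sub {u : ℝ} (hu : 0 < u) :
    Integrable fun y ↦ (gaussianPotential u α y - gaussianPotential u β y) ^ 2 := by
  have := integrable_energy α β fun μ hμ ↦ integrable_exp_mul_exp (d := d) hu μ
  simp_rw [energy_exp_mul_exp] at this
  exact this

/-- The Gaussian kernel is a superposition over `y` of product kernels, and the energy of a product
kernel is a square. In particular Gaussian energies are nonnegative. -/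
theorem energy_gaussianKernel {u : ℝ} (hu : 0 < u) :
    energy α β (gaussianKernel u) = (4 * u / π) ^ ((d + 1 : ℝ) / 2) *
      ∫ y, (gaussianPotential u α y - gaussianPotential u β y) ^ 2 := by
  have h4 : 0 < 4 * u := by positivity
  have h := energy_integral α β fun μ hμ ↦ integrable_exp_mul_exp (d := d) hu μ
  simp_rw [energy_exp_mul_exp] at h
  have h2 : ∀ p : UnitSphere d × UnitSphere d, ∫ y : EuclideanSpace ℝ (Fin (d + 1)),
      exp (-(2 * u) * dist (p.1 : EuclideanSpace ℝ (Fin (d + 1))) y ^ 2) *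
        exp (-(2 * u) * dist (p.2 : EuclideanSpace ℝ (Fin (d + 1))) y ^ 2) =
      0 + (π / (4 * u)) ^ ((d + 1 : ℝ) / 2) * gaussianKernel u p := fun p ↦ by
    simp_rw [exp_mul_exp_eq_gaussianKernel]
    rw [integral_const_mul, integral_exp_neg_mul_dist_sq h4]
    ring
  simp_rw [h2] at h
  rw [energy_const_add_mul _ _ _ _ fun μ _ ↦ integrable_gaussianKernel u μ] at h
  rw [← h, ← mul_assoc, ← mul_rpow (by positivity) (by positivity)]
  have : 4 * u / π * (π / (4 * u)) = 1 := by field_simp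
  rw [this, one_rpow, one_mul]

end GaussianPotential

/-! ### Restriction to one dyadic range of scales -/

open Real Set in
/-- A lower bound for the Gaussian energies over a dyadic range bounds the `L²` cap
discrepancy from below. -/
theorem exists_mul_le_cap_discrepancy (d : ℕ) :
    ∃ c : ℝ, 0 < c ∧ ∀ ν : Measure (UnitSphere d), IsProbabilityMeasure ν → ∀ L e : ℝ, 0 < L →
      0 ≤ e → (∀ u ∈ Icc L (2 * L), e ≤ energy ν (uniformSphere d) (gaussianKernel u)) →
      c * (L ^ (-(1 / 2) : ℝ) * e) ≤
        ∫ t in (-1 : ℝ)..1, ∫ x, |ν.real (sphericalCap x t)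
          - (uniformSphere d).real (sphericalCap x t)| ^ 2 ∂uniformSphere d := by
  obtain ⟨c, hc, h⟩ := exists_cap_discrepancy_eq_integral_energy d
  refine ⟨c * 2 ^ (-(3 / 2) : ℝ), by positivity, fun ν hν L e hL he hle ↦ ?_⟩
  obtain ⟨hint, heq⟩ := h ν hν
  rw [heq, mul_assoc]
  gcongr
  have hsub : Icc L (2 * L) ⊆ Ioi 0 := fun u hu ↦ hL.trans_le hu.1
  have hnn : ∀ u ∈ Ioi (0 : ℝ),
      0 ≤ u ^ (-(3 / 2) : ℝ) * energy ν (uniformSphere d) (gaussianKernel u) := fun u hu ↦ by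
    have hu0 : 0 < u := hu
    rw [energy_gaussianKernel _ _ hu0]
    have : 0 ≤ ∫ y, (gaussianPotential u ν y - gaussianPotential u (uniformSphere d) y) ^ 2 :=
      integral_nonneg fun _ ↦ sq_nonneg _
    positivity
  calc 2 ^ (-(3 / 2) : ℝ) * (L ^ (-(1 / 2) : ℝ) * e)
      = ∫ u in Icc L (2 * L), (2 * L) ^ (-(3 / 2) : ℝ) * e := by
        rw [setIntegral_const, smul_eq_mul, Real.volume_real_Icc_of_le (by linarith),
          mul_rpow two_pos.le hL.le]
        have : L ^ (-(1 / 2) : ℝ) = L ^ (1 : ℝ) * L ^ (-(3 / 2) : ℝ) := by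
          rw [← rpow_add hL]; norm_num
        rw [this, rpow_one]; ring
    _ ≤ ∫ u in Icc L (2 * L),
          u ^ (-(3 / 2) : ℝ) * energy ν (uniformSphere d) (gaussianKernel u) := by
        refine setIntegral_mono_on (integrableOn_const (by simp)) (hint.mono_set hsub) measurableSet_Icc
          fun u hu ↦ ?_
        have hu0 : 0 < u := hL.trans_le hu.1
        exact mul_le_mul (rpow_le_rpow_of_nonpos hu0 hu.2 (by norm_num)) (hle u hu) he
          (by positivity)
    _ ≤ _ := setIntegral_mono_set hint
        ((ae_restrict_iff' measurableSet_Ioi).2 (Filter.Eventually.of_forall hnn))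
        hsub.eventuallyLE

/-! ### Covering a regular set -/

/-- If balls of radius `ρ / 2` centred in `X` have measure at least `q`, then `X` is covered by at
most `1 / q` balls of radius `ρ`. -/
theorem exists_finset_cover_of_le_measure_ball {M : Type*} [PseudoMetricSpace M]
    [MeasurableSpace M] [OpensMeasurableSpace M] (ν : Measure M) [IsProbabilityMeasure ν]
    {X : Set M} {ρ q : ℝ} (hρ : 0 < ρ) (hq : 0 < q)
    (h : ∀ x ∈ X, q ≤ ν.real (ball x (ρ / 2))) :
    ∃ T : Finset M, T.card * q ≤ 1 ∧ ∀ x ∈ X, ∃ t ∈ T, dist x t < ρ := by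
  classical
  -- Half-radius balls around `ρ`-separated points are disjoint, which bounds their number. A
  -- separated set of maximal cardinality is therefore available, and it is a `ρ`-net.
  let P : Finset M → Prop := fun T ↦ (↑T ⊆ X) ∧ ∀ x ∈ T, ∀ y ∈ T, x ≠ y → ρ ≤ dist x y
  have hcard : ∀ T, P T → T.card * q ≤ 1 := fun T hT ↦ by
    have hd : (T : Set M).PairwiseDisjoint fun x ↦ ball x (ρ / 2) := fun x hx y hy hxy ↦
      ball_disjoint_ball (by rw [add_halves]; exact hT.2 x hx y hy hxy)
    calc (T.card : ℝ) * q = ∑ _x ∈ T, q := by simp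
      _ ≤ ∑ x ∈ T, ν.real (ball x (ρ / 2)) := Finset.sum_le_sum fun x hx ↦ h x (hT.1 hx)
      _ = ν.real (⋃ x ∈ T, ball x (ρ / 2)) :=
        (measureReal_biUnion_finset hd fun _ _ ↦ measurableSet_ball).symm
      _ ≤ 1 := measureReal_le_one
  let S : Set ℕ := {k | ∃ T, P T ∧ T.card = k}
  have hne : S.Nonempty := ⟨0, ∅, ⟨by simp, by simp⟩, rfl⟩
  have hbdd : BddAbove S := by
    refine ⟨⌊1 / q⌋₊, ?_⟩
    rintro _ ⟨T, hT, rfl⟩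
    exact Nat.le_floor ((le_div_iff₀ hq).2 (hcard T hT))
  obtain ⟨T, hT, hTc⟩ := Nat.sSup_mem hne hbdd
  refine ⟨T, hcard T hT, fun x hx ↦ ?_⟩
  by_contra! hfar
  have hxT : x ∉ T := fun hxT ↦ by
    have := hfar x hxT
    rw [dist_self] at this
    linarith
  have hins : P (insert x T) := by
    refine ⟨?_, ?_⟩
    · rw [Finset.coe_insert]
      exact Set.insert_subset hx hT.1
    · intro a ha b hb hab
      rcases Finset.mem_insert.1 ha with rfl | ha'
      · rcases Finset.mem_insert.1 hb with rfl | hb'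
        · exact absurd rfl hab
        · exact hfar b hb'
      · rcases Finset.mem_insert.1 hb with rfl | hb'
        · rw [dist_comm]; exact hfar a ha'
        · exact hT.2 a ha' b hb' hab
  have := le_csSup hbdd ⟨insert x T, hins, rfl⟩
  rw [Finset.card_insert_of_notMem hxT, hTc] at this
  omega

/-! ### Volume of a thin shell -/

section Shell

variable {d : ℕ}

/-- The open spherical shell `{1 - ε < ‖y‖ < 1}`. -/
def shell (d : ℕ) (ε : ℝ) : Set (EuclideanSpace ℝ (Fin (d + 1))) :=
  ball 0 1 \ closedBall 0 (1 - ε)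

/-- The volume of the unit ball of `ℝ ^ (d + 1)`. -/
noncomputable def unitBallVolume (d : ℕ) : ℝ :=
  (volume : Measure (EuclideanSpace ℝ (Fin (d + 1)))).real (ball 0 1)

theorem unitBallVolume_pos (d : ℕ) : 0 < unitBallVolume d :=
  ENNReal.toReal_pos (measure_ball_pos _ _ one_pos).ne' measure_ball_lt_top.ne

theorem volume_real_ball (x : EuclideanSpace ℝ (Fin (d + 1))) {r : ℝ} (hr : 0 ≤ r) :
    volume.real (ball x r) = r ^ (d + 1) * unitBallVolume d := by
  rw [measureReal_def, Measure.addHaar_ball _ _ hr, ENNReal.toReal_mul,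
    ENNReal.toReal_ofReal (by positivity), finrank_euclideanSpace_fin]
  rfl

theorem measurableSet_shell (ε : ℝ) : MeasurableSet (shell d ε) :=
  measurableSet_ball.diff measurableSet_closedBall

theorem volume_real_shell {ε : ℝ} (hε : 0 < ε) (hε1 : ε ≤ 1) :
    volume.real (shell d ε) = (1 - (1 - ε) ^ (d + 1)) * unitBallVolume d := by
  rw [shell, measureReal_sdiff (closedBall_subset_ball (by linarith)) measurableSet_closedBall
    (h₁ := measure_ball_lt_top.ne), volume_real_ball _ zero_le_one, measureReal_def,
    Measure.addHaar_closedBall_eq_addHaar_ball, ← measureReal_def,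
    volume_real_ball _ (by linarith)]
  ring

theorem le_volume_real_shell {ε : ℝ} (hε : 0 < ε) (hε1 : ε ≤ 1) :
    ε * unitBallVolume d ≤ volume.real (shell d ε) := by
  rw [volume_real_shell hε hε1]
  have := unitBallVolume_pos d
  gcongr
  have : (1 - ε) ^ (d + 1) ≤ 1 - ε :=
    pow_le_of_le_one (by linarith) (by linarith) (Nat.succ_ne_zero d)
  linarith

theorem volume_real_shell_le {ε : ℝ} (hε : 0 < ε) (hε1 : ε ≤ 1) :
    volume.real (shell d ε) ≤ (d + 1) * ε * unitBallVolume d := by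
  rw [volume_real_shell hε hε1]
  have := unitBallVolume_pos d
  gcongr
  have := one_add_mul_le_pow (a := -ε) (by linarith) (d + 1)
  rw [← sub_eq_add_neg] at this
  push_cast at this
  linarith

end Shell

/-! ### Potentials on the shell and the energy at one scale -/

section Potential

open Real

variable {d : ℕ}

/-- The uniform measure has Gaussian potential at least of order `ε ^ d` on the `ε`-shell. -/
theorem le_gaussianPotential_uniformSphere {ε u : ℝ} (hε : 0 < ε) (hε1 : ε ≤ 1)
    (hu0 : 0 < u) (hu : u * ε ^ 2 ≤ 2) {y : EuclideanSpace ℝ (Fin (d + 1))} (hy : y ∈ shell d ε) :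
    exp (-16) * ((ε / 4) ^ d / (2 * (d + 1))) ≤ gaussianPotential u (uniformSphere d) y := by
  have hy1 : ‖y‖ < 1 := by simpa using hy.1
  have hy2 : 1 - ε < ‖y‖ := by simpa using hy.2
  have hy0 : 0 < ‖y‖ := by linarith
  let p : UnitSphere d := ⟨‖y‖⁻¹ • y, by simp [norm_smul, hy0.ne']⟩
  have hpy : dist (p : EuclideanSpace ℝ (Fin (d + 1))) y < ε := by
    have : (p : EuclideanSpace ℝ (Fin (d + 1))) - y = (‖y‖⁻¹ - 1) • y := by
      simp only [p]; rw [sub_smul, one_smul]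
    rw [dist_eq_norm, this, norm_smul, Real.norm_of_nonneg (by
      rw [sub_nonneg]; exact (one_le_inv₀ hy0).2 hy1.le), sub_mul, inv_mul_cancel₀ hy0.ne']
    linarith
  have hball := le_uniformSphere_ball p (δ := ε / 4) (by positivity) (by linarith)
  rw [mul_div_cancel₀ _ (by norm_num : (4 : ℝ) ≠ 0)] at hball
  have hint : Integrable (fun z : UnitSphere d ↦
      exp (-(2 * u) * dist (z : EuclideanSpace ℝ (Fin (d + 1))) y ^ 2)) (uniformSphere d) :=
    Continuous.integrable_of_hasCompactSupport (by fun_prop) (HasCompactSupport.of_compactSpace _)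
  calc exp (-16) * ((ε / 4) ^ d / (2 * (d + 1)))
      ≤ exp (-16) * (uniformSphere d).real (ball p ε) := by gcongr
    _ = ∫ z in ball p ε, exp (-16) ∂uniformSphere d := by
        rw [setIntegral_const, smul_eq_mul, mul_comm]
    _ ≤ ∫ z in ball p ε, exp (-(2 * u) *
          dist (z : EuclideanSpace ℝ (Fin (d + 1))) y ^ 2) ∂uniformSphere d := by
        refine setIntegral_mono_on (integrableOn_const (measure_ne_top _ _)) hint.integrableOn
          measurableSet_ball fun z hz ↦ ?_
        -- The constant `16` arises from `2 * u * (2 * ε) ^ 2 = 8 * (u * ε ^ 2)` and `u * ε ^ 2 ≤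
        -- 2`.
        rw [exp_le_exp]
        have hz' : dist (z : EuclideanSpace ℝ (Fin (d + 1))) p < ε := hz
        have : dist (z : EuclideanSpace ℝ (Fin (d + 1))) y ≤ 2 * ε :=
          (dist_triangle _ (p : EuclideanSpace ℝ (Fin (d + 1))) _).trans (by linarith)
        have h2 : dist (z : EuclideanSpace ℝ (Fin (d + 1))) y ^ 2 ≤ (2 * ε) ^ 2 := by gcongr
        nlinarith [mul_le_mul_of_nonneg_left h2 hu0.le]
    _ ≤ _ := setIntegral_le_integral hint (Filter.Eventually.of_forall fun _ ↦ exp_nonneg _)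

theorem integrable_exp_restrict_prod (u : ℝ) (hu : 0 ≤ u)
    (ν : Measure (UnitSphere d)) [IsProbabilityMeasure ν]
    (m : Measure (EuclideanSpace ℝ (Fin (d + 1)))) [IsFiniteMeasure m] :
    Integrable (Function.uncurry fun (y : EuclideanSpace ℝ (Fin (d + 1))) (z : UnitSphere d) ↦
      exp (-(2 * u) * dist (z : EuclideanSpace ℝ (Fin (d + 1))) y ^ 2)) (m.prod ν) := by
  refine Integrable.of_bound (C := 1) (Measurable.aestronglyMeasurable ?_)
    (Filter.Eventually.of_forall fun q ↦ ?_)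
  · simp only [Function.uncurry_def]
    fun_prop
  · rw [Function.uncurry_def, Real.norm_of_nonneg (exp_nonneg _), exp_le_one_iff, neg_mul]
    exact neg_nonpos.2 (by positivity)

/-- Away from the support of `ν`, the Gaussian potential of `ν` is small on average. -/
theorem setIntegral_gaussianPotential_le {u r : ℝ} (hu : 0 < u) (hr : 0 ≤ r)
    (ν : Measure (UnitSphere d)) [IsProbabilityMeasure ν]
    {A : Set (EuclideanSpace ℝ (Fin (d + 1)))} (hA : MeasurableSet A) (hAfin : volume A ≠ ∞)
    (hfar : ∀ᵐ z : UnitSphere d ∂ν, ∀ y ∈ A, r ≤ dist (z : EuclideanSpace ℝ (Fin (d + 1))) y) :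
    ∫ y in A, gaussianPotential u ν y ≤ exp (-(u * r ^ 2)) * (π / u) ^ ((d + 1 : ℝ) / 2) := by
  have : IsFiniteMeasure (volume.restrict A) := ⟨by simpa using hAfin.lt_top⟩
  have hI := integrable_exp_restrict_prod u hu.le ν (volume.restrict A)
  simp only [gaussianPotential]
  rw [integral_integral_swap hI]
  have hle : ∀ᵐ z : UnitSphere d ∂ν, ∫ y in A, exp (-(2 * u) * dist (z : EuclideanSpace ℝ (Fin (d + 1))) y ^ 2) ≤
      exp (-(u * r ^ 2)) * (π / u) ^ ((d + 1 : ℝ) / 2) := by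
    filter_upwards [hfar] with z hz
    -- Half of the exponent `2 * u` pays for the distance `r`; the other half is integrated over the
    -- whole space.
    have hg := (integrable_exp_neg_mul_dist_sq hu (z : EuclideanSpace ℝ (Fin (d + 1)))).const_mul
      (exp (-(u * r ^ 2)))
    rw [← integral_exp_neg_mul_dist_sq hu (z : EuclideanSpace ℝ (Fin (d + 1))),
      ← integral_const_mul]
    refine (setIntegral_mono_on (integrable_exp_neg_mul_dist_sq (by positivity) _).integrableOn
      hg.integrableOn hA fun y hy ↦ ?_).trans (setIntegral_le_integral hg
        (Filter.Eventually.of_forall fun _ ↦ mul_nonneg (exp_nonneg _) (exp_nonneg _)))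
    rw [← exp_add, exp_le_exp]
    have h2 : r ^ 2 ≤ dist (z : EuclideanSpace ℝ (Fin (d + 1))) y ^ 2 := by
      have := hz y hy
      gcongr
    nlinarith [mul_le_mul_of_nonneg_left h2 hu.le]
  calc _ ≤ ∫ _z, exp (-(u * r ^ 2)) * (π / u) ^ ((d + 1 : ℝ) / 2) ∂ν :=
        integral_mono_ae hI.integral_prod_right (integrable_const _) hle
    _ = _ := by simp

/-- Cauchy–Schwarz on `A`, obtained by integrating `(f - c) ^ 2 ≥ 0` with the constant `c = Q / V`.
-/
theorem sq_div_le_integral_sq {α : Type*} [MeasurableSpace α] {m : Measure α} {f : α → ℝ}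
    {A : Set α} (hA : m A ≠ ∞) {Q V : ℝ} (hQ : 0 ≤ Q) (hV : 0 < V) (hAV : m.real A ≤ V)
    (hf : IntegrableOn f A m) (hf2 : Integrable (fun x ↦ f x ^ 2) m) (hQf : Q ≤ ∫ x in A, f x ∂m) :
    Q ^ 2 / V ≤ ∫ x, f x ^ 2 ∂m := by
  set c := Q / V
  have hc : 0 ≤ c := by positivity
  have hconst : IntegrableOn (fun _ ↦ c ^ 2) A m := integrableOn_const hA
  calc Q ^ 2 / V = 2 * c * Q - V * c ^ 2 := by simp only [c]; field_simp; ring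
    _ ≤ 2 * c * ∫ x in A, f x ∂m - m.real A * c ^ 2 := by gcongr
    _ = ∫ x in A, (2 * c * f x - c ^ 2) ∂m := by
        rw [integral_sub (hf.const_mul _) hconst, integral_const_mul, setIntegral_const, smul_eq_mul]
    _ ≤ ∫ x in A, f x ^ 2 ∂m := by
        refine integral_mono ((hf.const_mul _).sub hconst) hf2.integrableOn fun x ↦ ?_
        have := sq_nonneg (f x - c)
        simp only
        linarith
    _ ≤ _ := setIntegral_le_integral hf2 (Filter.Eventually.of_forall fun _ ↦ sq_nonneg _)

/-- If the measure `ν` stays away from a sizable part of the `ε`-shell, then its Gaussian energy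
at scale `ε` is at least of order `ε ^ d`. -/
theorem exists_mul_pow_le_energy (d : ℕ) : ∃ R : ℝ, 1 ≤ R ∧ ∃ c : ℝ, 0 < c ∧
    ∀ ν : Measure (UnitSphere d), IsProbabilityMeasure ν → ∀ ε u : ℝ, 0 < ε → ε ≤ 1 →
    1 ≤ u * ε ^ 2 → u * ε ^ 2 ≤ 2 → ∀ A ⊆ shell d ε, MeasurableSet A →
    ε * unitBallVolume d / 2 ≤ volume.real A →
    (∀ᵐ z : UnitSphere d ∂ν, ∀ y ∈ A, R * ε ≤ dist (z : EuclideanSpace ℝ (Fin (d + 1))) y) →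
    c * ε ^ d ≤ energy ν (uniformSphere d) (gaussianKernel u) := by
  set ω := unitBallVolume d
  have hω : 0 < ω := unitBallVolume_pos d
  -- The potential of the uniform measure has integral at least `2 * b * ε ^ (d + 1)` over `A`. The
  -- factor `R` is chosen so that `ν` contributes at most half of this.
  set b : ℝ := ω * exp (-16) * ((1 / 4) ^ d / (2 * (d + 1))) / 4
  have hb : 0 < b := by positivity
  obtain ⟨R, hR, hR1⟩ : ∃ R : ℝ, exp (-R) ≤ b / π ^ ((d + 1 : ℝ) / 2) ∧ 1 ≤ R := by
    have hpos : 0 < b / π ^ ((d + 1 : ℝ) / 2) := by positivity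
    exact ((tendsto_exp_neg_atTop_nhds_zero.eventually_le_const hpos).and
      (Filter.eventually_ge_atTop 1)).exists
  rw [le_div_iff₀ (by positivity)] at hR
  refine ⟨R, hR1, (4 / π) ^ ((d + 1 : ℝ) / 2) * (b ^ 2 / ((d + 1) * ω)), by positivity, ?_⟩
  intro ν hν ε u hε hε1 hu1 hu2 A hAs hA hAvol hfar
  have hu : 0 < u := by
    by_contra! h
    nlinarith [sq_nonneg ε]
  have hshell : volume (shell d ε) ≠ ∞ :=
    ((measure_mono Set.sdiff_subset).trans_lt measure_ball_lt_top).ne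
  have hAfin : volume A ≠ ∞ := ((measure_mono hAs).trans_lt hshell.lt_top).ne
  have : IsFiniteMeasure (volume.restrict A) := ⟨by simpa using hAfin.lt_top⟩
  have hν_int : IntegrableOn (gaussianPotential u ν) A :=
    (integrable_exp_restrict_prod u hu.le ν (volume.restrict A)).integral_prod_left
  have hσ_int : IntegrableOn (gaussianPotential u (uniformSphere d)) A :=
    (integrable_exp_restrict_prod u hu.le (uniformSphere d)
      (volume.restrict A)).integral_prod_left
  have hpi : (π / u) ^ ((d + 1 : ℝ) / 2) ≤ π ^ ((d + 1 : ℝ) / 2) * ε ^ (d + 1) := by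
    have h1 : π / u ≤ π * ε ^ 2 := by
      rw [div_le_iff₀ hu]
      nlinarith [pi_pos]
    calc (π / u) ^ ((d + 1 : ℝ) / 2) ≤ (π * ε ^ 2) ^ ((d + 1 : ℝ) / 2) := by gcongr
      _ = _ := by
        rw [mul_rpow pi_pos.le (by positivity), ← rpow_natCast ε 2, ← rpow_mul hε.le,
          ← rpow_natCast ε (d + 1)]
        push_cast
        congr 2
        ring
  have hνle : ∫ y in A, gaussianPotential u ν y ≤ b * ε ^ (d + 1) := by
    calc _ ≤ exp (-(u * (R * ε) ^ 2)) * (π / u) ^ ((d + 1 : ℝ) / 2) :=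
          setIntegral_gaussianPotential_le hu (by positivity) ν hA hAfin hfar
      _ ≤ exp (-R) * (π ^ ((d + 1 : ℝ) / 2) * ε ^ (d + 1)) := by
          gcongr
          have : R ≤ R ^ 2 := by nlinarith
          nlinarith [mul_le_mul_of_nonneg_left hu1 (sq_nonneg R)]
      _ ≤ _ := by
          rw [← mul_assoc]
          gcongr
  have hσle : 2 * b * ε ^ (d + 1) ≤ ∫ y in A, gaussianPotential u (uniformSphere d) y := by
    have hle : ∫ _y in A, exp (-16) * ((ε / 4) ^ d / (2 * (d + 1))) ≤
        ∫ y in A, gaussianPotential u (uniformSphere d) y :=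
      setIntegral_mono_on (integrableOn_const hAfin) hσ_int hA fun y hy ↦
        le_gaussianPotential_uniformSphere hε hε1 hu hu2 (hAs hy)
    rw [setIntegral_const, smul_eq_mul] at hle
    refine le_trans ?_ hle
    calc 2 * b * ε ^ (d + 1) = ε * ω / 2 * (exp (-16) * ((ε / 4) ^ d / (2 * (d + 1)))) := by
          simp only [b, div_pow]; ring
      _ ≤ _ := by gcongr
  have hQ : b * ε ^ (d + 1) ≤
      ∫ y in A, (gaussianPotential u (uniformSphere d) y - gaussianPotential u ν y) := by
    rw [integral_sub hσ_int hν_int]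
    linarith
  have hsq := integrable_sq_gaussianPotential_sub ν (uniformSphere d) hu
  simp_rw [sub_sq_comm (gaussianPotential u ν _)] at hsq
  have hmain := sq_div_le_integral_sq hAfin (by positivity)
    (by positivity : 0 < (d + 1) * ε * ω)
    ((measureReal_mono hAs hshell).trans (volume_real_shell_le hε hε1))
    (hσ_int.sub hν_int) hsq hQ
  rw [energy_gaussianKernel _ _ hu]
  simp_rw [sub_sq_comm (gaussianPotential u ν _)]
  have h4 : (4 / π) ^ ((d + 1 : ℝ) / 2) ≤ (4 * u / π) ^ ((d + 1 : ℝ) / 2) * ε ^ (d + 1) := by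
    calc (4 / π) ^ ((d + 1 : ℝ) / 2) ≤ (4 * u / π * ε ^ 2) ^ ((d + 1 : ℝ) / 2) := by
          gcongr
          calc 4 / π = 4 / π * 1 := (mul_one _).symm
            _ ≤ 4 / π * (u * ε ^ 2) := by gcongr
            _ = _ := by ring
      _ = _ := by
        rw [mul_rpow (by positivity) (by positivity), ← rpow_natCast ε 2, ← rpow_mul hε.le,
          ← rpow_natCast ε (d + 1)]
        push_cast
        congr 2
        ring
  calc (4 / π) ^ ((d + 1 : ℝ) / 2) * (b ^ 2 / ((d + 1) * ω)) * ε ^ d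
      ≤ (4 * u / π) ^ ((d + 1 : ℝ) / 2) * ε ^ (d + 1) * (b ^ 2 / ((d + 1) * ω)) * ε ^ d := by
        gcongr
    _ = (4 * u / π) ^ ((d + 1 : ℝ) / 2) * ((b * ε ^ (d + 1)) ^ 2 / ((d + 1) * ε * ω)) := by
        field_simp
        ring
    _ ≤ _ := mul_le_mul_of_nonneg_left hmain (by positivity)

end Potential

/-! ### Choice of the scale and conclusion -/

/-- If `X` carries a probability measure with lower regularity constant `1 / N`, a sizable part of
the `ε`-shell stays away from `X` at the scale `ε = (K N) ^ (-1 / (d - s))`. -/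
theorem exists_shell_subset_far {d : ℕ} {s R N : ℝ} (hs0 : 0 ≤ s) (hsd : s < d) (hR : 1 ≤ R)
    (hN : 1 ≤ N) (ν : Measure (UnitSphere d)) [IsProbabilityMeasure ν] {X : Set (UnitSphere d)}
    (hX : ∀ x ∈ X, ∀ r : ℝ, 0 < r → r < 1 → r ^ s / N ≤ ν.real (ball x r))
    {ε : ℝ} (hε : 0 < ε) (hε1 : ε ≤ 1)
    (hεN : ε ^ (d - s) * (2 ^ s * 2 ^ (d + 2) * R ^ (d + 1) * N) = 1) :
    ∃ A ⊆ shell d ε, MeasurableSet A ∧ ε * unitBallVolume d / 2 ≤ volume.real A ∧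
      ∀ x ∈ X, ∀ y ∈ A, R * ε ≤ dist (x : EuclideanSpace ℝ (Fin (d + 1))) y := by
  have hds : 0 < d - s := by linarith
  have hR0 : 0 < R := by linarith
  have hN0 : 0 < N := by linarith
  have hω := unitBallVolume_pos d
  set ρ := R * ε
  have hρ : 0 < ρ := by positivity
  have h2s : (1 : ℝ) ≤ 2 ^ s := Real.one_le_rpow one_le_two hs0
  have hRds' : R ^ (d - s) * R ≤ R ^ (d + 1) := by
    rw [← Real.rpow_add_one hR0.ne', ← Real.rpow_natCast R (d + 1)]
    exact Real.rpow_le_rpow_of_exponent_le hR (by push_cast; linarith)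
  have hRds : R ^ (d - s) ≤ R ^ (d + 1) :=
    (le_mul_of_one_le_right (by positivity) hR).trans hRds'
  have hρN : ρ ^ (d - s) * (2 ^ s * 2 ^ (d + 2) * N) ≤ 1 := by
    rw [Real.mul_rpow hR0.le hε.le, ← hεN]
    calc _ ≤ R ^ (d + 1) * ε ^ (d - s) * (2 ^ s * 2 ^ (d + 2) * N) := by gcongr
      _ = _ := by ring
  -- Needed because lower regularity, applied below at radius `ρ / 2`, only concerns radii less than
  -- one.
  have hρ1 : ρ ≤ 1 := by
    by_contra! h
    have h1 : 1 < ρ ^ (d - s) := Real.one_lt_rpow h hds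
    have h2 : (1 : ℝ) ≤ 2 ^ (d + 2) := one_le_pow₀ one_le_two
    have h3 : 1 ≤ 2 ^ s * 2 ^ (d + 2) * N :=
      one_le_mul_of_one_le_of_one_le (one_le_mul_of_one_le_of_one_le h2s h2) hN
    nlinarith
  obtain ⟨T, hTc, hT⟩ := exists_finset_cover_of_le_measure_ball ν hρ
    (by positivity : 0 < (ρ / 2) ^ s / N)
    fun x hx ↦ hX x hx (ρ / 2) (by positivity) (by linarith)
  -- Doubling the radius `ρ` of the cover keeps points outside `U` at distance at least `ρ` from
  -- `X`.
  set U : Set (EuclideanSpace ℝ (Fin (d + 1))) :=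
    ⋃ t ∈ T, ball (t : EuclideanSpace ℝ (Fin (d + 1))) (2 * ρ)
  have hU : MeasurableSet U := Finset.measurableSet_biUnion _ fun _ _ ↦ measurableSet_ball
  have hUvol : volume.real U ≤ ε * unitBallVolume d / 2 := by
    have h1 : volume.real U ≤ T.card * ((2 * ρ) ^ (d + 1) * unitBallVolume d) :=
      calc volume.real U
          ≤ ∑ t ∈ T, volume.real (ball (t : EuclideanSpace ℝ (Fin (d + 1))) (2 * ρ)) :=
            measureReal_biUnion_finset_le _ _
        _ = _ := by
            simp_rw [volume_real_ball _ (by positivity : 0 ≤ 2 * ρ)]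
            simp
    have h2 : T.card * ρ ^ s ≤ 2 ^ s * N := by
      rw [Real.div_rpow hρ.le two_pos.le, div_div, mul_div_assoc', div_le_one (by positivity)]
        at hTc
      exact hTc
    have h3 : ρ ^ (d + 1) = ρ ^ s * (ρ ^ (d - s) * ρ) := by
      rw [← Real.rpow_add_one hρ.ne', ← Real.rpow_add hρ, ← Real.rpow_natCast]
      push_cast
      congr 1
      ring
    -- The normalization of `ε` is made for this bound: `2 ^ s` comes from the radius `ρ / 2` in the
    -- packing, `2 ^ (d + 1)` from the doubled balls, one further `2` from keeping half of the
    -- shell, and `R ^ (d + 1)` dominates the powers of `R` in `ρ`.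
    have h4 : ρ ^ (d - s) * ρ * (2 ^ s * N) * 2 ^ (d + 2) ≤ ε := by
      calc ρ ^ (d - s) * ρ * (2 ^ s * N) * 2 ^ (d + 2)
          = R ^ (d - s) * R * (ε ^ (d - s) * (2 ^ s * 2 ^ (d + 2) * N)) * ε := by
            rw [Real.mul_rpow hR0.le hε.le]; ring
        _ ≤ R ^ (d + 1) * (ε ^ (d - s) * (2 ^ s * 2 ^ (d + 2) * N)) * ε := by
            gcongr
        _ = ε ^ (d - s) * (2 ^ s * 2 ^ (d + 2) * R ^ (d + 1) * N) * ε := by ring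
        _ = ε := by rw [hεN, one_mul]
    calc volume.real U ≤ T.card * ((2 * ρ) ^ (d + 1) * unitBallVolume d) := h1
      _ = T.card * ρ ^ s * (ρ ^ (d - s) * ρ) * 2 ^ (d + 1) * unitBallVolume d := by
        rw [mul_pow, h3]; ring
      _ ≤ 2 ^ s * N * (ρ ^ (d - s) * ρ) * 2 ^ (d + 1) * unitBallVolume d := by gcongr
      _ = ρ ^ (d - s) * ρ * (2 ^ s * N) * 2 ^ (d + 2) * unitBallVolume d / 2 := by ring
      _ ≤ _ := by gcongr
  refine ⟨shell d ε \ U, Set.sdiff_subset, (measurableSet_shell ε).diff hU, ?_, ?_⟩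
  · have h1 := le_volume_real_shell (d := d) hε hε1
    have h2 : volume.real (shell d ε) ≤ volume.real (shell d ε \ U) + volume.real U := by
      have hUfin : volume U < ∞ :=
        ((Bornology.isBounded_biUnion_finset T).2 fun _ _ ↦ isBounded_ball).measure_lt_top
      have hSfin : volume (shell d ε \ U) < ∞ :=
        (measure_mono (Set.sdiff_subset.trans Set.sdiff_subset)).trans_lt measure_ball_lt_top
      refine (measureReal_mono (by rw [Set.sdiff_union_self]; exact Set.subset_union_left)
        (measure_union_lt_top hSfin hUfin).ne).trans (measureReal_union_le _ _)
    linarith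
  · intro x hx y hy
    obtain ⟨t, ht, hxt⟩ := hT x hx
    have hyt : y ∉ ball (t : EuclideanSpace ℝ (Fin (d + 1))) (2 * ρ) := fun h ↦
      hy.2 (Set.mem_biUnion ht h)
    rw [mem_ball, not_lt] at hyt
    have hxt' : dist (x : EuclideanSpace ℝ (Fin (d + 1))) t < ρ := hxt
    have := dist_triangle y (x : EuclideanSpace ℝ (Fin (d + 1))) t
    rw [dist_comm y x.1] at this
    linarith

/-- The discrepancy bound for a probability measure carried by a lower regular set. -/
theorem exists_rpow_le_cap_discrepancy (d : ℕ) {s : ℝ} (hs0 : 0 ≤ s) (hsd : s < d) :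
    ∃ c : ℝ, 0 < c ∧ ∀ ν : Measure (UnitSphere d), IsProbabilityMeasure ν →
      ∀ (X : Set (UnitSphere d)) (N : ℝ), 1 ≤ N → (∀ F, IsClosed F → X ⊆ F → ν Fᶜ = 0) →
      (∀ x ∈ X, ∀ r : ℝ, 0 < r → r < 1 → r ^ s / N ≤ ν.real (ball x r)) →
      c * N ^ (-(((d : ℝ) + 1) / (d - s))) ≤
        ∫ t in (-1 : ℝ)..1, ∫ x, |ν.real (sphericalCap x t)
          - (uniformSphere d).real (sphericalCap x t)| ^ 2 ∂uniformSphere d := by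
  obtain ⟨R, hR, c₁, hc₁, hE⟩ := exists_mul_pow_le_energy d
  obtain ⟨c₂, hc₂, hD⟩ := exists_mul_le_cap_discrepancy d
  have hds : 0 < d - s := by linarith
  have hR0 : 0 < R := by linarith
  set K : ℝ := 2 ^ s * 2 ^ (d + 2) * R ^ (d + 1)
  have hK : 1 ≤ K := one_le_mul_of_one_le_of_one_le (one_le_mul_of_one_le_of_one_le
    (Real.one_le_rpow one_le_two hs0) (one_le_pow₀ one_le_two)) (one_le_pow₀ hR)
  have hK0 : 0 < K := by linarith
  refine ⟨c₂ * (c₁ * K ^ (-(((d : ℝ) + 1) / (d - s)))), by positivity, ?_⟩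
  intro ν hν X N hN hcar hreg
  have hN0 : 0 < N := by linarith
  set ε : ℝ := (K * N) ^ (-(1 / (d - s)))
  have hε : 0 < ε := by positivity
  have hε1 : ε ≤ 1 := Real.rpow_le_one_of_one_le_of_nonpos
    (one_le_mul_of_one_le_of_one_le hK hN) (neg_nonpos.2 (by positivity))
  have hεN : ε ^ (d - s) * (K * N) = 1 := by
    simp only [ε]
    rw [← Real.rpow_mul (by positivity), neg_mul, one_div_mul_cancel hds.ne', Real.rpow_neg_one,
      inv_mul_cancel₀ (by positivity)]
  obtain ⟨A, hAs, hA, hAvol, hfar⟩ := exists_shell_subset_far hs0 hsd hR hN ν hreg hε hε1 hεN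
  -- Being far from `A` is a closed condition that holds on `X`. Passing through closed supersets
  -- avoids any measurability of `X`.
  have hae : ∀ᵐ z : UnitSphere d ∂ν, ∀ y ∈ A,
      R * ε ≤ dist (z : EuclideanSpace ℝ (Fin (d + 1))) y := by
    refine hcar {z | ∀ y ∈ A, R * ε ≤ dist (z : EuclideanSpace ℝ (Fin (d + 1))) y} ?_ hfar
    simp only [Set.ofPred_forall]
    exact isClosed_biInter fun y _ ↦ isClosed_le continuous_const (by fun_prop)
  -- With `L = ε⁻²` the weight `L ^ (-1/2)` equals `ε`, which raises `ε ^ d` to `ε ^ (d + 1)`.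
  have h := hD ν hν (ε ^ 2)⁻¹ (c₁ * ε ^ d) (by positivity) (by positivity) fun u hu ↦ by
    have h1 : (ε ^ 2)⁻¹ * ε ^ 2 = 1 := inv_mul_cancel₀ (by positivity)
    refine hE ν hν ε u hε hε1 ?_ ?_ A hAs hA hAvol hae
    · rw [← h1]; gcongr; exact hu.1
    · calc u * ε ^ 2 ≤ 2 * (ε ^ 2)⁻¹ * ε ^ 2 := by gcongr; exact hu.2
        _ = 2 := by rw [mul_assoc, h1, mul_one]
  refine le_trans (le_of_eq ?_) h
  have h1 : ((ε ^ 2)⁻¹ : ℝ) ^ (-(1 / 2) : ℝ) = ε := by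
    rw [Real.inv_rpow (by positivity), Real.rpow_neg (by positivity), inv_inv,
      ← Real.sqrt_eq_rpow, Real.sqrt_sq hε.le]
  have h2 : ε ^ (d + 1) = K ^ (-(((d : ℝ) + 1) / (d - s))) * N ^ (-(((d : ℝ) + 1) / (d - s))) := by
    rw [← Real.mul_rpow hK0.le hN0.le, ← Real.rpow_natCast, ← Real.rpow_mul (by positivity)]
    push_cast
    congr 1
    ring
  rw [h1, show ε * (c₁ * ε ^ d) = c₁ * ε ^ (d + 1) by ring, h2]
  ring

theorem mainTheorem2 (d : ℕ) (hd : 2 ≤ d) (s : ℝ) (hs0 : 0 ≤ s) (hsd : s < d) :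
    ∃ c : ℝ, 0 < c ∧ ∀ (X : Set (UnitSphere d)) (a : ℝ),
      dimH X = ENNReal.ofReal s → 1 ≤ μH[s] X → μH[s] X < ∞ → IsLowerADRegular s a X →
      c * ((μH[s] X).toReal / a) ^ (-(((d : ℝ) + 1) / (2 * ((d : ℝ) - s)))) ≤
        capDiscrepancy s X := by
  obtain ⟨c, hc, h⟩ := exists_rpow_le_cap_discrepancy d hs0 hsd
  refine ⟨√c, Real.sqrt_pos.2 hc, fun X a _ hX1 hXfin hreg ↦ ?_⟩
  obtain ⟨ha, hreg⟩ := hreg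
  set M := (μH[s] X).toReal
  have hX0 : μH[s] X ≠ 0 := (one_pos.trans_le hX1).ne'
  have hM : 0 < M := ENNReal.toReal_pos hX0 hXfin.ne
  -- This gives `N = M / a ≥ 1`. Regularity is assumed only for radii below one, so the bound is
  -- obtained by letting `ε` tend to one.
  have hMa : a ≤ M := by
    obtain ⟨x, hx⟩ : X.Nonempty := nonempty_of_measure_ne_zero hX0
    have hle : ∀ ε : ℝ, 0 < ε → ε < 1 → a * ε ^ s ≤ M := fun ε h0 h1 ↦
      (ENNReal.ofReal_le_iff_le_toReal hXfin.ne).1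
        ((hreg x hx ε h0 h1).trans (measure_mono Set.inter_subset_right))
    have hlim : Filter.Tendsto (fun ε : ℝ ↦ a * ε ^ s) (nhdsWithin 1 (Set.Iio 1)) (nhds a) := by
      have : ContinuousAt (fun ε : ℝ ↦ a * ε ^ s) 1 :=
        continuousAt_const.mul (Real.continuousAt_rpow_const _ _ (Or.inl one_ne_zero))
      simpa using this.tendsto.mono_left nhdsWithin_le_nhds
    refine le_of_tendsto hlim ?_
    filter_upwards [Ioo_mem_nhdsLT (zero_lt_one' ℝ)] with ε hε using hle ε hε.1 hε.2
  let ν : Measure (UnitSphere d) := (μH[s] X)⁻¹ • (μH[s]).restrict X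
  have hν : IsProbabilityMeasure ν := ⟨by
    simp only [ν, Measure.smul_apply, Measure.restrict_apply_univ, smul_eq_mul]
    exact ENNReal.inv_mul_cancel hX0 hXfin.ne⟩
  have hνreal : ∀ B : Set (UnitSphere d), MeasurableSet B →
      ν.real B = (μH[s] (X ∩ B)).toReal / M := fun B hB ↦ by
    rw [measureReal_def, Measure.smul_apply, Measure.restrict_apply hB, smul_eq_mul,
      ENNReal.toReal_mul, ENNReal.toReal_inv, Set.inter_comm, div_eq_inv_mul]
  have hD := h ν hν X (M / a) ((one_le_div ha).2 hMa) (fun F hF hXF ↦ by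
      rw [Measure.smul_apply, Measure.restrict_apply hF.isOpen_compl.measurableSet]
      have : Fᶜ ∩ X = ∅ := by
        rw [← Set.disjoint_iff_inter_eq_empty]
        exact Set.disjoint_compl_left_iff_subset.2 hXF
      simp [this])
    (fun x hx r hr0 hr1 ↦ by
      rw [hνreal _ measurableSet_ball, div_div_eq_mul_div]
      gcongr
      rw [mul_comm, Set.inter_comm]
      exact (ENNReal.ofReal_le_iff_le_toReal
        ((measure_mono Set.inter_subset_right).trans_lt hXfin).ne).1 (hreg x hx r hr0 hr1))
  rw [capDiscrepancy]
  -- The bound is proved for the squared discrepancy; the square root halves the exponent.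
  refine Real.le_sqrt_of_sq_le ?_
  refine le_trans (le_of_eq ?_) (hD.trans (le_of_eq ?_))
  · rw [mul_pow, Real.sq_sqrt hc.le, ← Real.rpow_natCast (_ ^ _) 2,
      ← Real.rpow_mul (by positivity)]
    congr 2
    push_cast
    have : (d : ℝ) - s ≠ 0 := by linarith
    field_simp
  · simp_rw [hνreal _ (measurableSet_sphericalCap _ _), measureReal_def]
    rfl
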